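/- Let $H$ be a complex Hilbert space with inner product $\langle\cdot,\cdot\rangle$ and let $T$ be a bounded linear operator on $H$. Let $\mathcal D_{\rm const}(T)$ be the set of all $\lambda\in\mathbb C$ for which there is an orthonormal basis $(u_j)_{j\in J}$ of $H$ with $\langle Tu_j,u_j\rangle=\lambda$ for all $j\in J$ (the constant diagonals of $T$), and let $W_e(T)$ be the essential numerical range of $T$, that is, the set of all $\lambda\in\mathbb C$ for which there is an infinite orthonormal sequence $(u_j)_{j\ge1}$ in $H$ with $\lim_{j\to\infty}\langle Tu_j,u_j\rangle=\lambda$. (a) If $H$ is separable, $\alpha\in\mathcal D_{\rm const}(T)$ and $\beta\in W_e(T)$, then $t\alpha+(1-t)\beta\in\mathcal D_{\rm const}(T)$ for every $t\in(0,1)$. (b) For $H$ of any dimension (finite or infinite, separable or not), the set $\mathcal D_{\rm const}(T)$ is convex. -/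

import Mathlib

universe u

/-- The set of constant diagonals of a bounded operator `T` on a complex Hilbert space `H`: all
`c : ℂ` for which some orthonormal (Hilbert) basis `(b j)` of `H` satisfies `⟨T (b j), b j⟩ = c` for
every `j`. Mathlib's inner product is linear in the second variable, so the number written
`⟨T x, x⟩` with an inner product linear in the first variable is `inner ℂ x (T x)`. The index type
of the basis is arbitrary; it is countable when `H` is separable. -/
def constantDiagonals {H : Type u} [NormedAddCommGroup H] [InnerProductSpace ℂ H]
    (T : H →L[ℂ] H) : Set ℂ :=
  {c | ∃ (ι : Type u) (b : HilbertBasis ι ℂ H), ∀ j, inner ℂ (b j) (T (b j)) = c}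

/-- The essential numerical range of a bounded operator `T` on a complex Hilbert space `H`: all
limits of `⟨T (v j), v j⟩` along infinite orthonormal sequences `(v j)` in `H`. -/
def essentialNumericalRange {H : Type u} [NormedAddCommGroup H] [InnerProductSpace ℂ H]
    (T : H →L[ℂ] H) : Set ℂ :=
  {c | ∃ v : ℕ → H, Orthonormal ℂ v ∧
    Filter.Tendsto (fun j => inner ℂ (v j) (T (v j))) Filter.atTop (nhds c)}

/-! If α = β nothing needs to be done; otherwise pass to A = (T - α)/(β - α), which has zero
diagonal along an orthonormal sequence u. Since an orthonormal sequence is asymptotically orthogonal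
to any finite set of vectors, 1 is a limit of values of A on every tail span(u_j, j ≥ N). The
numerical range on a tail is convex (Toeplitz–Hausdorff), and zero trace on finite blocks puts a
point opposite each of its points; hence it contains all of [0, 1) itself, not merely in its closure
(`ofReal_mem_numericalRangeOn_tail`).

To reach the diagonal c = 1 - t < 1, add to u_0, …, u_{N-1} a number q of tail vectors with value
c(N+q)/q, which is below 1 for large q. Their joint span has dimension N+q and trace c(N+q), so any
orthonormal set in it with diagonal c extends to an orthonormal basis of it with diagonal c
(`exists_orthonormal_diagonal_extension`). Iteration exhausts u. All stages stay in the algebraic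
span of u, so density of the new span is inherited.

For two bases b and d of an arbitrary space, linking vectors with nonzero inner product splits b
into countable pieces, each with the same closed span as a piece of d. On an infinite piece β is an
essential value and the construction applies; on a nonempty finite piece comparing traces gives α =
β. -/

/-- The values `⟨A x, x⟩` at the unit vectors `x` of a subspace `E`. -/
def numericalRangeOn {H : Type*} [NormedAddCommGroup H] [InnerProductSpace ℂ H]
    (A : H →ₗ[ℂ] H) (E : Submodule ℂ H) : Set ℂ :=
  {c | ∃ x ∈ E, ‖x‖ = 1 ∧ inner ℂ x (A x) = c}

/-! ### Convexity of the numerical range -/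

section NumericalRange

variable {H : Type*} [NormedAddCommGroup H] [InnerProductSpace ℂ H]

theorem numericalRangeOn_mono (A : H →ₗ[ℂ] H) {E F : Submodule ℂ H} (h : E ≤ F) :
    numericalRangeOn A E ⊆ numericalRangeOn A F :=
  fun _ ⟨x, hx, hn, hc⟩ => ⟨x, h hx, hn, hc⟩

theorem mem_numericalRangeOn_of_ne_zero {A : H →ₗ[ℂ] H} {E : Submodule ℂ H} {x : H} {c : ℂ}
    (hx : x ∈ E) (h0 : x ≠ 0) (h : inner ℂ x (A x) = c * (‖x‖ : ℂ) ^ 2) :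
    c ∈ numericalRangeOn A E := by
  have hn : (‖x‖ : ℂ) ≠ 0 := by simpa using h0
  refine ⟨((‖x‖⁻¹ : ℝ) : ℂ) • x, E.smul_mem _ hx, ?_, ?_⟩
  · rw [norm_smul]
    simp [h0]
  · rw [map_smul, inner_smul_left, inner_smul_right, h, Complex.conj_ofReal]
    push_cast
    field_simp

/-- The value of `c • (A - a)` at a unit vector. -/
theorem inner_smul_sub_smul_one (A : H →ₗ[ℂ] H) (a c : ℂ) {x : H} (hx : ‖x‖ = 1) :
    inner ℂ x ((c • (A - a • (1 : H →ₗ[ℂ] H))) x) = c * (inner ℂ x (A x) - a) := by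
  simp only [LinearMap.smul_apply, LinearMap.sub_apply, Module.End.one_apply, inner_smul_right,
    inner_sub_right, inner_self_eq_norm_sq_to_K, hx]
  simp

theorem exists_unit_mul_im_eq_zero (d : ℂ) : ∃ w : ℂ, ‖w‖ = 1 ∧ (w * d).im = 0 := by
  rcases eq_or_ne d 0 with rfl | hd
  · exact ⟨1, by simp, by simp⟩
  · have hn : (‖d‖ : ℂ) ≠ 0 := by simpa using hd
    refine ⟨(starRingEnd ℂ) d / ‖d‖, by simp [hd], ?_⟩
    have : (starRingEnd ℂ) d / ‖d‖ * d = ((‖d‖ : ℝ) : ℂ) := by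
      field_simp
      rw [Complex.conj_mul']
    rw [this, Complex.ofReal_im]

theorem ofReal_mem_numericalRangeOn {A : H →ₗ[ℂ] H} {E : Submodule ℂ H} {x y : H}
    (hx : x ∈ E) (hy : y ∈ E) (hxn : ‖x‖ = 1) (hyn : ‖y‖ = 1)
    (hx0 : inner ℂ x (A x) = 0) (hy1 : inner ℂ y (A y) = 1) {s : ℝ} (hs0 : 0 ≤ s) (hs1 : s ≤ 1) :
    (s : ℂ) ∈ numericalRangeOn A E := by
  -- This phase `w` makes the cross term real, so the quadratic form is real along the segment from
  -- `w • x` to `y`.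
  obtain ⟨w, hw, hwd⟩ :=
    exists_unit_mul_im_eq_zero (inner ℂ y (A x) - (starRingEnd ℂ) (inner ℂ x (A y)))
  set c : ℝ := ((starRingEnd ℂ) w * inner ℂ x (A y) + w * inner ℂ y (A x)).re with hc
  have hcc : (starRingEnd ℂ) w * inner ℂ x (A y) + w * inner ℂ y (A x) = (c : ℂ) := by
    apply Complex.ext
    · simp [hc]
    · simp only [Complex.add_im, Complex.mul_im, Complex.sub_im, Complex.sub_re, Complex.conj_im,
        Complex.conj_re, Complex.ofReal_im] at hwd ⊢
      linarith
  have hww : (starRingEnd ℂ) w * w = 1 := by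
    rw [Complex.conj_mul', hw]; simp
  let z : ℝ → H := fun r => ((1 - r : ℝ) : ℂ) • w • x + (r : ℂ) • y
  have hzE : ∀ r, z r ∈ E := fun r =>
    E.add_mem (E.smul_mem _ (E.smul_mem _ hx)) (E.smul_mem _ hy)
  have hz : ∀ r : ℝ, inner ℂ (z r) (A (z r)) = ((r ^ 2 + r * (1 - r) * c : ℝ) : ℂ) := by
    intro r
    simp only [z, map_add, map_smul, inner_add_left, inner_add_right, inner_smul_left,
      inner_smul_right, hx0, hy1, Complex.conj_ofReal]
    push_cast
    rw [← hcc]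
    ring
  have hcont : Continuous fun r : ℝ => r ^ 2 + r * (1 - r) * c - s * ‖z r‖ ^ 2 := by
    fun_prop
  have h0 : ‖z 0‖ = 1 := by simp [z, norm_smul, hw, hxn]
  have h1 : ‖z 1‖ = 1 := by simp [z, hyn]
  obtain ⟨r, ⟨hr0, hr1⟩, hr⟩ := intermediate_value_Icc (zero_le_one (α := ℝ)) hcont.continuousOn
    (show (0 : ℝ) ∈ _ by
      constructor
      · rw [h0]; nlinarith
      · rw [h1]; nlinarith)
  refine mem_numericalRangeOn_of_ne_zero (hzE r) ?_ ?_
  -- If `z r = 0`, then `y` is a multiple of `x`, contradicting the values 0 at `x` and 1 at `y`.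
  · intro hzr
    have he : ((1 - r : ℝ) : ℂ) • w • x = (-(r : ℂ)) • y := by
      rw [neg_smul]; exact eq_neg_of_add_eq_zero_left hzr
    have hn := congrArg norm he
    rw [norm_smul, norm_smul, norm_smul, norm_neg, Complex.norm_real, Complex.norm_real, hw, hxn,
      hyn, Real.norm_of_nonneg (by linarith), Real.norm_of_nonneg hr0] at hn
    have hr2 : r = 1 / 2 := by linarith
    have hyx : y = (-w) • x := by
      rw [hr2] at he
      have h2 : ((1 - 1 / 2 : ℝ) : ℂ) = 1 / 2 := by push_cast; norm_num
      have h3 : ((1 / 2 : ℝ) : ℂ) = 1 / 2 := by push_cast; norm_num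
      rw [h2, h3] at he
      have h4 := congrArg (fun v => (-2 : ℂ) • v) he
      simp only [smul_smul] at h4
      norm_num at h4
      rw [neg_smul]
      simpa using h4.symm
    rw [hyx, map_smul, inner_smul_left, inner_smul_right, hx0] at hy1
    simp at hy1
  · rw [hz]
    have : r ^ 2 + r * (1 - r) * c = s * ‖z r‖ ^ 2 := by
      simp only at hr; linarith
    rw [this]
    push_cast
    rfl

/-- The Toeplitz–Hausdorff theorem. -/
theorem convex_numericalRangeOn (A : H →ₗ[ℂ] H) (E : Submodule ℂ H) :
    Convex ℝ (numericalRangeOn A E) := by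
  rintro a ⟨x, hx, hxn, hxa⟩ b ⟨y, hy, hyn, hyb⟩ p s hp hs hps
  rcases eq_or_ne a b with rfl | hab
  · rw [← add_smul, hps, one_smul]
    exact ⟨x, hx, hxn, hxa⟩
  · have hba : b - a ≠ 0 := sub_ne_zero.2 hab.symm
    obtain ⟨z, hz, hzn, hzs⟩ := ofReal_mem_numericalRangeOn
      (A := (b - a)⁻¹ • (A - a • (1 : H →ₗ[ℂ] H))) hx hy hxn hyn
      (by rw [inner_smul_sub_smul_one A a _ hxn, hxa]; simp)
      (by rw [inner_smul_sub_smul_one A a _ hyn, hyb]; field_simp) hs (by linarith)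
    rw [inner_smul_sub_smul_one A a _ hzn] at hzs
    refine ⟨z, hz, hzn, ?_⟩
    have hp' : p = 1 - s := by linarith
    have : inner ℂ z (A z) - a = s * (b - a) := by
      field_simp at hzs
      linear_combination hzs
    rw [hp', Complex.real_smul, Complex.real_smul]
    push_cast
    linear_combination this

end NumericalRange

/-! ### Constant diagonals in finite dimension, by the trace -/

section ConstantDiagonal

variable {H : Type*} [NormedAddCommGroup H] [InnerProductSpace ℂ H]

theorem orthonormal_coe_insert {s : Set H} (hs : Orthonormal ℂ ((↑) : s → H)) {x : H}
    (hx : ‖x‖ = 1) (hxs : ∀ y ∈ s, inner ℂ y x = 0) :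
    Orthonormal ℂ (Subtype.val : ↥(insert x s) → H) := by
  classical
  rw [orthonormal_subtype_iff_ite] at hs ⊢
  have hxx : inner ℂ x x = 1 := by rw [inner_self_eq_norm_sq_to_K, hx]; simp
  have hxs' : ∀ y ∈ s, inner ℂ x y = 0 := fun y hy => inner_eq_zero_symm.1 (hxs y hy)
  have hne : ∀ y ∈ s, x ≠ y := by
    rintro y hy rfl
    rw [hxs x hy] at hxx
    exact zero_ne_one hxx
  rintro v (rfl | hv) w (rfl | hw)
  · rw [hxx, if_pos rfl]
  · rw [hxs' w hw, if_neg (hne w hw)]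
  · rw [hxs v hv, if_neg (hne v hv).symm]
  · exact hs v hv w hw

/-- In any orthonormal completion of `s`, the trace leaves the added vectors an average value `c`.
By convexity `c` is then attained at a unit vector orthogonal to `s`; adjoin it and repeat. Here `n`
counts the missing vectors. -/
theorem exists_orthonormal_diagonal_extension_of_trace {E : Type*} [NormedAddCommGroup E]
    [InnerProductSpace ℂ E] [FiniteDimensional ℂ E] (A : E →ₗ[ℂ] E) {c : ℂ}
    (hA : LinearMap.trace ℂ E A = Module.finrank ℂ E * c) (n : ℕ) :
    ∀ s : Finset E, Orthonormal ℂ (Subtype.val : ↥(s : Set E) → E) → (∀ x ∈ s, inner ℂ x (A x) = c) →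
      s.card + n = Module.finrank ℂ E →
      ∃ t : Finset E, s ⊆ t ∧ Orthonormal ℂ (Subtype.val : ↥(t : Set E) → E) ∧
        (∀ x ∈ t, inner ℂ x (A x) = c) ∧ t.card = Module.finrank ℂ E := by
  classical
  induction n with
  | zero => exact fun s hs hc hn => ⟨s, subset_rfl, hs, hc, hn⟩
  | succ n ih =>
    intro s hs hc hn
    obtain ⟨u, b, hsu, hb⟩ := hs.exists_orthonormalBasis_extension
    have hsu' : s ⊆ u := by exact_mod_cast hsu
    have hu : Orthonormal ℂ (Subtype.val : ↥(u : Set E) → E) := by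
      have := b.orthonormal
      rw [hb] at this
      exact this
    have hcard : u.card = Module.finrank ℂ E := by
      rw [Module.finrank_eq_card_basis b.toBasis, Fintype.card_coe]
    have htr : ∑ x ∈ u, inner ℂ x (A x) = u.card * c := by
      rw [hcard, ← hA, LinearMap.trace_eq_sum_inner A b, hb,
        ← Finset.sum_coe_sort u (fun x => inner ℂ x (A x))]
    have hd : (u \ s).card = n + 1 := by
      rw [Finset.card_sdiff_of_subset hsu']; omega
    have hsum : ∑ x ∈ u \ s, inner ℂ x (A x) = (n + 1 : ℕ) * c := by
      have h1 := Finset.sum_sdiff (f := fun x => inner ℂ x (A x)) hsu'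
      rw [htr, Finset.sum_congr rfl hc, Finset.sum_const, nsmul_eq_mul] at h1
      have h2 : (u.card : ℂ) = (n + 1 : ℕ) + s.card := by
        rw [hcard, ← hn]; push_cast; ring
      rw [h2] at h1
      linear_combination h1
    have horth : ∀ x ∈ s, ∀ y ∈ u \ s, inner ℂ x y = 0 := by
      intro x hx y hy
      rw [orthonormal_subtype_iff_ite] at hu
      rw [hu x (hsu' hx) y (Finset.mem_sdiff.1 hy).1, if_neg]
      rintro rfl
      exact (Finset.mem_sdiff.1 hy).2 hx
    have hmem : c ∈ numericalRangeOn A (Submodule.span ℂ (s : Set E))ᗮ := by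
      have h3 := (convex_numericalRangeOn A (Submodule.span ℂ (s : Set E))ᗮ).sum_mem
        (t := u \ s) (w := fun _ => ((n + 1 : ℕ) : ℝ)⁻¹) (z := fun x => inner ℂ x (A x))
        (fun _ _ => by positivity)
        (by rw [Finset.sum_const, hd, nsmul_eq_mul]; field_simp)
        (fun x hx => ⟨x, ?_, hu.norm_eq_one ⟨x, (Finset.mem_sdiff.1 hx).1⟩, rfl⟩)
      · rw [← Finset.smul_sum, hsum, Complex.real_smul] at h3
        convert h3 using 1
        push_cast
        field_simp
      · rw [Submodule.mem_orthogonal]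
        intro y hy
        induction hy using Submodule.span_induction with
        | mem y hy => exact horth y hy x hx
        | zero => simp
        | add y z _ _ h1 h2 => rw [inner_add_left, h1, h2, add_zero]
        | smul a y _ h => rw [inner_smul_left, h, mul_zero]
    obtain ⟨x, hx, hxn, hxc⟩ := hmem
    have hxs : ∀ y ∈ s, inner ℂ y x = 0 := fun y hy =>
      (Submodule.mem_orthogonal _ _).1 hx y (Submodule.subset_span hy)
    have hxs' : x ∉ s := fun h => by
      have := hxs x h
      rw [inner_self_eq_zero] at this
      simp [this] at hxn
    obtain ⟨t, hst, ht⟩ := ih (insert x s)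
      (by rw [Finset.coe_insert]; exact orthonormal_coe_insert hs hxn hxs)
      (by
        intro y hy
        rcases Finset.mem_insert.1 hy with rfl | hy
        · exact hxc
        · exact hc y hy)
      (by rw [Finset.card_insert_of_notMem hxs']; omega)
    exact ⟨t, (Finset.subset_insert _ _).trans hst, ht⟩

/-- The compression of `A` to a finite-dimensional subspace. -/
noncomputable def compression (A : H →ₗ[ℂ] H) (V : Submodule ℂ H) [FiniteDimensional ℂ V] : V →ₗ[ℂ] V :=
  V.orthogonalProjectionOnto.toLinearMap ∘ₗ A ∘ₗ V.subtype

theorem inner_compression (A : H →ₗ[ℂ] H) (V : Submodule ℂ H) [FiniteDimensional ℂ V] (x y : V) :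
    inner ℂ x (compression A V y) = inner ℂ (x : H) (A y) := by
  simp [compression]

theorem exists_orthonormalBasis_of_span_range_eq {κ : Type*} [Fintype κ] {f : κ → H}
    (hf : Orthonormal ℂ f) {V : Submodule ℂ H} (hV : Submodule.span ℂ (Set.range f) = V) :
    ∃ b : OrthonormalBasis κ ℂ V, ∀ k, (b k : H) = f k := by
  have hfV : ∀ k, f k ∈ V := fun k => hV ▸ Submodule.subset_span ⟨k, rfl⟩
  let g : κ → V := fun k => ⟨f k, hfV k⟩
  have hg : Orthonormal ℂ g := by
    classical
    rw [orthonormal_iff_ite] at hf ⊢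
    exact hf
  suffices h : ⊤ ≤ Submodule.span ℂ (Set.range g) from
    ⟨OrthonormalBasis.mk hg h, fun k => by simp [g]⟩
  rintro ⟨x, hx⟩ -
  have h1 : (Submodule.span ℂ (Set.range g)).map V.subtype = V := by
    rw [Submodule.map_span, ← Set.range_comp]
    exact hV
  obtain ⟨y, hy, hyx⟩ : x ∈ (Submodule.span ℂ (Set.range g)).map V.subtype := by rwa [h1]
  have : y = ⟨x, hx⟩ := Subtype.ext hyx
  exact this ▸ hy

theorem trace_compression (A : H →ₗ[ℂ] H) {V : Submodule ℂ H} [FiniteDimensional ℂ V]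
    {κ : Type*} [Fintype κ] {f : κ → H} (hf : Orthonormal ℂ f)
    (hV : Submodule.span ℂ (Set.range f) = V) :
    LinearMap.trace ℂ V (compression A V) = ∑ k, inner ℂ (f k) (A (f k)) := by
  classical
  obtain ⟨b, hb⟩ := exists_orthonormalBasis_of_span_range_eq hf hV
  rw [LinearMap.trace_eq_sum_inner _ b]
  exact Finset.sum_congr rfl fun k _ => by rw [inner_compression, hb]

theorem exists_orthonormal_diagonal_extension (A : H →ₗ[ℂ] H) {c : ℂ} {κ : Type*} [Fintype κ]
    {f : κ → H} (hf : Orthonormal ℂ f)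
    (hsum : ∑ k, inner ℂ (f k) (A (f k)) = Fintype.card κ * c)
    {s : Set H} (hs : Orthonormal ℂ ((↑) : s → H))
    (hsf : s ⊆ Submodule.span ℂ (Set.range f)) (hsc : ∀ x ∈ s, inner ℂ x (A x) = c) :
    ∃ t : Set H, s ⊆ t ∧ Orthonormal ℂ ((↑) : t → H) ∧ (∀ x ∈ t, inner ℂ x (A x) = c) ∧
      Submodule.span ℂ t = Submodule.span ℂ (Set.range f) := by
  classical
  obtain ⟨V, hV⟩ : ∃ V, Submodule.span ℂ (Set.range f) = V := ⟨_, rfl⟩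
  have hfin : FiniteDimensional ℂ V := hV ▸ FiniteDimensional.span_of_finite ℂ (Set.finite_range f)
  rw [hV] at hsf ⊢
  have htr := trace_compression A hf hV
  obtain ⟨b, -⟩ := exists_orthonormalBasis_of_span_range_eq hf hV
  rw [hsum, ← Module.finrank_eq_card_basis b.toBasis] at htr
  have hs' : Orthonormal ℂ (Subtype.val : ↥((↑) ⁻¹' s : Set V) → V) := by
    rw [orthonormal_subtype_iff_ite] at hs ⊢
    intro v hv w hw
    rw [Submodule.coe_inner, hs v hv w hw]
    simp only [Subtype.ext_iff]
  have hsfin : ((↑) ⁻¹' s : Set V).Finite := hs'.linearIndependent.setFinite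
  have hcard : hsfin.toFinset.card ≤ Module.finrank ℂ V := by
    have := hsfin.fintype
    have h := hs'.linearIndependent.fintype_card_le_finrank
    rwa [← Set.toFinset_card, ← hsfin.toFinset_eq_toFinset] at h
  obtain ⟨t, hst, ht, htc, htn⟩ := exists_orthonormal_diagonal_extension_of_trace
    (compression A V) htr (Module.finrank ℂ V - hsfin.toFinset.card) hsfin.toFinset
    (by rw [hsfin.coe_toFinset]; exact hs')
    (fun x hx => by rw [inner_compression]; exact hsc _ (hsfin.mem_toFinset.1 hx))
    (by omega)
  refine ⟨(↑) '' (t : Set V), ?_, ?_, ?_, ?_⟩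
  · intro x hx
    exact ⟨⟨x, hsf hx⟩, hst (hsfin.mem_toFinset.2 hx), rfl⟩
  · rw [orthonormal_subtype_iff_ite] at ht ⊢
    rintro _ ⟨v, hv, rfl⟩ _ ⟨w, hw, rfl⟩
    rw [← Submodule.coe_inner, ht v hv w hw]
    simp only [Subtype.ext_iff]
  · rintro _ ⟨v, hv, rfl⟩
    rw [← inner_compression]
    exact htc v hv
  · have h1 : Submodule.span ℂ (t : Set V) = ⊤ := by
      have := LinearIndependent.span_eq_top_of_card_eq_finrank'
        (b := (Subtype.val : ↥(t : Set V) → V)) ht.linearIndependent (by simpa using htn)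
      simpa using this
    have h2 := congrArg (Submodule.map V.subtype) h1
    rw [Submodule.map_span, Submodule.map_subtype_top] at h2
    exact h2

/-- Both sums are the trace of the compression to the common span. -/
theorem sum_inner_eq_of_span_range_eq (A : H →ₗ[ℂ] H) {κ κ' : Type*} [Fintype κ] [Fintype κ']
    {f : κ → H} {g : κ' → H} (hf : Orthonormal ℂ f) (hg : Orthonormal ℂ g)
    (h : Submodule.span ℂ (Set.range f) = Submodule.span ℂ (Set.range g)) :
    Fintype.card κ = Fintype.card κ' ∧
      ∑ k, inner ℂ (f k) (A (f k)) = ∑ k, inner ℂ (g k) (A (g k)) := by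
  have hfin : FiniteDimensional ℂ (Submodule.span ℂ (Set.range g)) :=
    FiniteDimensional.span_of_finite ℂ (Set.finite_range g)
  obtain ⟨b, -⟩ := exists_orthonormalBasis_of_span_range_eq hf h
  obtain ⟨b', -⟩ := exists_orthonormalBasis_of_span_range_eq hg rfl
  exact ⟨by rw [← Module.finrank_eq_card_basis b.toBasis, Module.finrank_eq_card_basis b'.toBasis],
    by rw [← trace_compression A hf h, trace_compression A hg rfl]⟩

end ConstantDiagonal

/-! ### From zero diagonal to a constant diagonal in [0, 1) -/

section ZeroDiagonal

variable {H : Type*} [NormedAddCommGroup H] [InnerProductSpace ℂ H]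

/-- Complete a vector with value `z` to an orthonormal basis of the span: the remaining values sum
to `-z`, and their average lies in the range by convexity. -/
theorem exists_neg_mul_mem_numericalRangeOn (A : H →ₗ[ℂ] H) {κ : Type*} [Fintype κ] {f : κ → H}
    (hf : Orthonormal ℂ f) (hsum : ∑ k, inner ℂ (f k) (A (f k)) = 0) {z : ℂ}
    (hz : z ∈ numericalRangeOn A (Submodule.span ℂ (Set.range f))) :
    ∃ m : ℝ, 0 < m ∧ -(m : ℂ) * z ∈ numericalRangeOn A (Submodule.span ℂ (Set.range f)) := by
  classical
  obtain ⟨V, hV⟩ : ∃ V, Submodule.span ℂ (Set.range f) = V := ⟨_, rfl⟩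
  have hfin : FiniteDimensional ℂ V := hV ▸ FiniteDimensional.span_of_finite ℂ (Set.finite_range f)
  have htr := trace_compression A hf hV
  rw [hV] at hz ⊢
  obtain ⟨x, hx, hxn, hxz⟩ := id hz
  have hs : Orthonormal ℂ (Subtype.val : ↥({⟨x, hx⟩} : Set V) → V) := by
    have := orthonormal_coe_insert (s := (∅ : Set V)) (orthonormal_empty ℂ V)
      (x := ⟨x, hx⟩) hxn (by simp)
    rwa [insert_empty_eq] at this
  obtain ⟨w, b, hw, hb⟩ := hs.exists_orthonormalBasis_extension
  have hxw : (⟨x, hx⟩ : V) ∈ w := hw rfl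
  rw [hsum, LinearMap.trace_eq_sum_inner _ b, hb,
    Finset.sum_coe_sort w (fun y => inner ℂ y (compression A V y)),
    ← Finset.add_sum_erase _ _ hxw, inner_compression, hxz] at htr
  simp only [inner_compression] at htr
  have htr' := eq_neg_of_add_eq_zero_right htr
  rcases Nat.eq_zero_or_pos (w.erase ⟨x, hx⟩).card with h0 | h0
  · rw [Finset.card_eq_zero.1 h0, Finset.sum_empty] at htr'
    have hz0 : z = 0 := by simpa using htr'.symm
    exact ⟨1, one_pos, by simpa [hz0] using hz⟩
  · have hn : ∀ y ∈ w, ‖y‖ = 1 := fun y hy => by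
      have := b.orthonormal.norm_eq_one ⟨y, hy⟩
      rwa [hb] at this
    have hc : ((w.erase ⟨x, hx⟩).card : ℝ) ≠ 0 := by positivity
    have h := (convex_numericalRangeOn A V).sum_mem (t := w.erase ⟨x, hx⟩)
      (w := fun _ => ((w.erase ⟨x, hx⟩).card : ℝ)⁻¹) (z := fun y => inner ℂ (y : H) (A y))
      (fun _ _ => by positivity)
      (by rw [Finset.sum_const, nsmul_eq_mul, mul_inv_cancel₀ hc])
      (fun y hy => ⟨y, y.2, hn y (Finset.mem_of_mem_erase hy), rfl⟩)
    rw [← Finset.smul_sum, htr', Complex.real_smul] at h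
    refine ⟨((w.erase ⟨x, hx⟩).card : ℝ)⁻¹, by positivity, ?_⟩
    convert h using 1
    ring

/-- The point is where the segment from `w` to `p` crosses the real axis. -/
theorem ofReal_mem_of_convex_of_im_neg_pos {S : Set ℂ} (hS : Convex ℝ S) {w p : ℂ} (hw : w ∈ S)
    (hp : p ∈ S) (h : w.im < 0 ∧ 0 < p.im ∨ 0 < w.im ∧ p.im < 0) :
    (((w.re * p.im - p.re * w.im) / (p.im - w.im) : ℝ) : ℂ) ∈ S := by
  have hne : p.im - w.im ≠ 0 := by
    rcases h with h | h
    · linarith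
    · exact ne_of_lt (by linarith)
  have h1 : 0 ≤ p.im / (p.im - w.im) := by
    rcases h with h | h
    · exact div_nonneg h.2.le (by linarith)
    · exact div_nonneg_of_nonpos h.2.le (by linarith)
  have h2 : 0 ≤ -w.im / (p.im - w.im) := by
    rcases h with h | h
    · exact div_nonneg (by linarith) (by linarith)
    · exact div_nonneg_of_nonpos (by linarith) (by linarith)
  convert hS hw hp h1 h2 (by field_simp; ring) using 1
  apply Complex.ext
  · simp only [Complex.add_re, Complex.smul_re, Complex.ofReal_re, smul_eq_mul]
    field_simp
    ring
  · simp only [Complex.add_im, Complex.smul_im, Complex.ofReal_im, smul_eq_mul]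
    field_simp
    ring

/-- If `S` is real, a point of `S` near 1 lies beyond `s`. Otherwise `hneg` gives points strictly on
both sides of the real axis, and joining a point near 1 to the one on the other side crosses the
axis near 1. Either way shrink towards 0. -/
theorem ofReal_mem_of_one_mem_closure {S : Set ℂ} (hS : Convex ℝ S) (h0 : (0 : ℂ) ∈ S)
    (hneg : ∀ z ∈ S, ∃ m : ℝ, 0 < m ∧ -(m : ℂ) * z ∈ S) (h1 : (1 : ℂ) ∈ closure S)
    {s : ℝ} (hs0 : 0 ≤ s) (hs1 : s < 1) : (s : ℂ) ∈ S := by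
  have key : ∀ r : ℝ, s < r → (r : ℂ) ∈ S → (s : ℂ) ∈ S := by
    intro r hr hrS
    have hr0 : 0 < r := hs0.trans_lt hr
    have := hS.smul_mem_of_zero_mem h0 hrS
      (t := s / r) ⟨by positivity, (div_le_one hr0).2 hr.le⟩
    rw [Complex.real_smul, ← Complex.ofReal_mul, div_mul_cancel₀ _ hr0.ne'] at this
    exact this
  have hfreq := mem_closure_iff_frequently.1 h1
  have hre : ∀ᶠ w : ℂ in nhds 1, s < w.re :=
    Complex.continuous_re.continuousAt.eventually (lt_mem_nhds (by simpa using hs1))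
  by_cases hreal : ∀ z ∈ S, z.im = 0
  · obtain ⟨w, hwS, hw⟩ := (hfreq.and_eventually hre).exists
    refine key w.re hw ?_
    convert hwS
    exact Complex.ext (by simp) (by simp [hreal w hwS])
  · push Not at hreal
    obtain ⟨z, hz, hzi⟩ := hreal
    obtain ⟨m, hm, hmz⟩ := hneg z hz
    have him : (-(m : ℂ) * z).im = -(m * z.im) := by simp
    obtain ⟨p, hp, hpi, n, hn, hni⟩ : ∃ p ∈ S, 0 < p.im ∧ ∃ n ∈ S, n.im < 0 := by
      rcases lt_or_gt_of_ne hzi with h | h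
      · exact ⟨_, hmz, by rw [him]; nlinarith, z, hz, h⟩
      · exact ⟨z, hz, h, _, hmz, by rw [him]; nlinarith⟩
    -- The crossing abscissa is continuous in `w` and equals 1 at `w = 1`.
    have hF : ∀ p : ℂ, p.im ≠ 0 →
        ∀ᶠ w : ℂ in nhds 1, s < (w.re * p.im - p.re * w.im) / (p.im - w.im) := by
      intro p hp
      have hc : ContinuousAt
          (fun w : ℂ => (w.re * p.im - p.re * w.im) / (p.im - w.im)) 1 := by
        refine ContinuousAt.div (by fun_prop) (by fun_prop) (by simpa using hp)
      refine hc.eventually (lt_mem_nhds ?_)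
      simpa [hp] using hs1
    obtain ⟨w, hwS, hw, hwp, hwn⟩ := (hfreq.and_eventually
      (hre.and ((hF p hpi.ne').and (hF n hni.ne)))).exists
    rcases lt_trichotomy w.im 0 with h | h | h
    · exact key _ hwp (ofReal_mem_of_convex_of_im_neg_pos hS hwS hp (Or.inl ⟨h, hpi⟩))
    · refine key w.re hw ?_
      convert hwS
      exact Complex.ext (by simp) (by simp [h])
    · exact key _ hwn (ofReal_mem_of_convex_of_im_neg_pos hS hwS hn (Or.inr ⟨h, hni⟩))

theorem exists_mem_span_image_Ico {u : ℕ → H} {N : ℕ} {x : H}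
    (hx : x ∈ Submodule.span ℂ (u '' Set.Ici N)) :
    ∃ M, N < M ∧ x ∈ Submodule.span ℂ (u '' Set.Ico N M) := by
  induction hx using Submodule.span_induction with
  | mem x hx =>
    obtain ⟨j, hj, rfl⟩ := hx
    exact ⟨j + 1, Nat.lt_succ_of_le hj, Submodule.subset_span ⟨j, ⟨hj, Nat.lt_succ_self j⟩, rfl⟩⟩
  | zero => exact ⟨N + 1, Nat.lt_succ_self N, Submodule.zero_mem _⟩
  | add x y _ _ hx hy =>
    obtain ⟨M, hM, hx⟩ := hx
    obtain ⟨M', hM', hy⟩ := hy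
    refine ⟨max M M', hM.trans_le (le_max_left _ _), Submodule.add_mem _ ?_ ?_⟩
    · exact Submodule.span_mono (Set.image_mono (Set.Ico_subset_Ico_right (le_max_left _ _))) hx
    · exact Submodule.span_mono (Set.image_mono (Set.Ico_subset_Ico_right (le_max_right _ _))) hy
  | smul a x _ hx =>
    obtain ⟨M, hM, hx⟩ := hx
    exact ⟨M, hM, Submodule.smul_mem _ a hx⟩

theorem Orthonormal.inner_eq_zero_of_mem_span_image {ι : Type*} {u : ι → H}
    (hu : Orthonormal ℂ u) {s t : Set ι} (hst : Disjoint s t) {x y : H}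
    (hx : x ∈ Submodule.span ℂ (u '' s)) (hy : y ∈ Submodule.span ℂ (u '' t)) :
    inner ℂ x y = 0 := by
  have h : Submodule.span ℂ (u '' s) ⟂ Submodule.span ℂ (u '' t) := by
    rw [Submodule.isOrtho_span]
    rintro _ ⟨i, hi, rfl⟩ _ ⟨j, hj, rfl⟩
    exact hu.inner_eq_zero (fun h => Set.disjoint_left.1 hst hi (h ▸ hj))
  exact Submodule.IsOrtho.inner_eq h hx hy

theorem ofReal_mem_numericalRangeOn_tail (A : H →ₗ[ℂ] H) {u : ℕ → H} (hu : Orthonormal ℂ u)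
    (h0 : ∀ j, inner ℂ (u j) (A (u j)) = 0) {N : ℕ}
    (h1 : (1 : ℂ) ∈ closure (numericalRangeOn A (Submodule.span ℂ (u '' Set.Ici N))))
    {s : ℝ} (hs0 : 0 ≤ s) (hs1 : s < 1) :
    (s : ℂ) ∈ numericalRangeOn A (Submodule.span ℂ (u '' Set.Ici N)) := by
  refine ofReal_mem_of_one_mem_closure (convex_numericalRangeOn A _)
    ⟨u N, Submodule.subset_span (Set.mem_image_of_mem u Set.self_mem_Ici), hu.norm_eq_one N, h0 N⟩ ?_ h1 hs0 hs1
  rintro z ⟨x, hx, hxn, hxz⟩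
  obtain ⟨M, -, hxM⟩ := exists_mem_span_image_Ico hx
  have hr : Set.range (fun j : Set.Ico N M => u j) = u '' Set.Ico N M := by
    ext y; simp
  obtain ⟨m, hm, hmz⟩ := exists_neg_mul_mem_numericalRangeOn A
    (f := fun j : Set.Ico N M => u j) (hu.comp _ Subtype.val_injective) (by simp [h0])
    (z := z) ⟨x, by rwa [hr], hxn, hxz⟩
  rw [hr] at hmz
  exact ⟨m, hm, numericalRangeOn_mono A
    (Submodule.span_mono (Set.image_mono Set.Ico_subset_Ici_self)) hmz⟩

theorem exists_orthonormal_diagonal_in_blocks (A : H →ₗ[ℂ] H) {u : ℕ → H} (hu : Orthonormal ℂ u)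
    {c : ℂ} (hc : ∀ N, c ∈ numericalRangeOn A (Submodule.span ℂ (u '' Set.Ici N)))
    (N q : ℕ) : ∃ M, ∃ v : Fin q → H, Orthonormal ℂ v ∧
      (∀ i, v i ∈ Submodule.span ℂ (u '' Set.Ico N M)) ∧ ∀ i, inner ℂ (v i) (A (v i)) = c := by
  have h : ∀ N, ∃ M, N < M ∧ ∃ x ∈ Submodule.span ℂ (u '' Set.Ico N M), ‖x‖ = 1 ∧
      inner ℂ x (A x) = c := by
    intro N
    obtain ⟨x, hx, hxn, hxc⟩ := hc N
    obtain ⟨M, hM, hxM⟩ := exists_mem_span_image_Ico hx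
    exact ⟨M, hM, x, hxM, hxn, hxc⟩
  choose next hnext x hx hxn hxc using h
  -- Endpoints of consecutive disjoint blocks, each holding one vector.
  let a : ℕ → ℕ := fun i => next^[i] N
  have hsucc : ∀ i, a (i + 1) = next (a i) := fun i => Function.iterate_succ_apply' next i N
  have ha : StrictMono a := strictMono_nat_of_lt_succ fun i => by rw [hsucc]; exact hnext _
  have hmem : ∀ i, x (a i) ∈ Submodule.span ℂ (u '' Set.Ico (a i) (a (i + 1))) := fun i => by
    rw [hsucc]; exact hx _
  have horth : ∀ i j, i < j → inner ℂ (x (a i)) (x (a j)) = 0 := fun i j hij =>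
    hu.inner_eq_zero_of_mem_span_image (by
      rw [Set.disjoint_left]
      intro k hk hk'
      have : a (i + 1) ≤ a j := ha.monotone hij
      exact absurd hk.2 (not_lt.2 (this.trans hk'.1))) (hmem i) (hmem j)
  refine ⟨a q, fun i => x (a i), ⟨fun i => hxn _, ?_⟩, fun i => ?_, fun i => hxc _⟩
  · intro i j hij
    rcases lt_or_gt_of_ne (fun h => hij (Fin.ext h)) with h | h
    · exact horth _ _ h
    · exact inner_eq_zero_symm.1 (horth _ _ h)
  · refine Submodule.span_mono (Set.image_mono (Set.Ico_subset_Ico ?_ ?_)) (hmem i)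
    · exact ha.monotone (Nat.zero_le i)
    · exact ha.monotone i.2

theorem exists_orthonormal_diagonal_step (A : H →ₗ[ℂ] H) {u : ℕ → H} (hu : Orthonormal ℂ u)
    (h0 : ∀ j, inner ℂ (u j) (A (u j)) = 0)
    (h1 : ∀ N, (1 : ℂ) ∈ closure (numericalRangeOn A (Submodule.span ℂ (u '' Set.Ici N))))
    {c : ℝ} (hc0 : 0 ≤ c) (hc1 : c < 1) {N : ℕ} {s : Set H}
    (hs : Orthonormal ℂ (Subtype.val : s → H)) (hsN : s ⊆ Submodule.span ℂ (u '' Set.Iio N))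
    (hsc : ∀ x ∈ s, inner ℂ x (A x) = c) :
    ∃ M, ∃ t : Set H, N < M ∧ s ⊆ t ∧ Orthonormal ℂ (Subtype.val : t → H) ∧
      t ⊆ Submodule.span ℂ (u '' Set.Iio M) ∧ (∀ x ∈ t, inner ℂ x (A x) = c) ∧
      u '' Set.Iio N ⊆ Submodule.span ℂ t := by
  -- This bound on `q` is exactly `c * (N + q) / q < 1`.
  obtain ⟨q, hq⟩ := exists_nat_gt (c * N / (1 - c))
  rw [div_lt_iff₀ (by linarith)] at hq
  have hq0 : (0 : ℝ) < q := by
    by_contra hq0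
    have : 0 ≤ c * N := by positivity
    nlinarith
  have hcN : 0 ≤ c * (N + q) / q := by positivity
  obtain ⟨M, v, hv, hvm, hvc⟩ := exists_orthonormal_diagonal_in_blocks A hu
    (fun K => ofReal_mem_numericalRangeOn_tail A hu h0 (h1 K) hcN
      ((div_lt_one hq0).2 (by linarith))) N q
  let f : Fin N ⊕ Fin q → H := Sum.elim (fun i => u i) v
  have huv : ∀ (i : Fin N) (j : Fin q), inner ℂ (u i) (v j) = 0 := fun i j =>
    hu.inner_eq_zero_of_mem_span_image (s := Set.Iio N) (t := Set.Ico N M)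
      (Set.disjoint_left.2 fun k hk hk' => absurd hk (not_lt.2 hk'.1))
      (Submodule.subset_span (Set.mem_image_of_mem u i.2)) (hvm j)
  have hf : Orthonormal ℂ f := by
    constructor
    · rintro (i | i)
      · exact hu.norm_eq_one i
      · exact hv.norm_eq_one i
    · rintro (i | i) (j | j) hij
      · exact hu.inner_eq_zero fun h => hij (congrArg Sum.inl (Fin.ext h))
      · exact huv i j
      · exact inner_eq_zero_symm.1 (huv j i)
      · exact hv.inner_eq_zero fun h => hij (congrArg Sum.inr h)
  have huf : u '' Set.Iio N ⊆ Submodule.span ℂ (Set.range f) := by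
    rintro _ ⟨i, hi, rfl⟩
    exact Submodule.subset_span ⟨Sum.inl ⟨i, hi⟩, rfl⟩
  have hsum : ∑ k, inner ℂ (f k) (A (f k)) = Fintype.card (Fin N ⊕ Fin q) * (c : ℂ) := by
    have hq' : (q : ℂ) ≠ 0 := by exact_mod_cast hq0.ne'
    simp only [f, Fintype.sum_sum_type, Sum.elim_inl, Sum.elim_inr, h0, hvc]
    simp only [Finset.sum_const, Finset.card_univ, Fintype.card_fin, Fintype.card_sum, smul_zero,
      nsmul_eq_mul]
    push_cast
    field_simp
    ring
  obtain ⟨t, hst, ht, htc, htf⟩ := exists_orthonormal_diagonal_extension A hf hsum hs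
    (hsN.trans (Submodule.span_le.2 huf)) hsc
  -- The maximum forces strict growth of the index, so that every `u j` is eventually absorbed.
  refine ⟨max M (N + 1), t, lt_max_of_lt_right (Nat.lt_succ_self N), hst, ht, ?_, htc, ?_⟩
  · have hfM : Submodule.span ℂ (Set.range f) ≤
        Submodule.span ℂ (u '' Set.Iio (max M (N + 1))) := by
      rw [Submodule.span_le]
      rintro _ ⟨i | i, rfl⟩
      · exact Submodule.subset_span (Set.mem_image_of_mem u
          (Set.mem_Iio.2 (lt_max_of_lt_right (i.2.trans (Nat.lt_succ_self N)))))
      · exact Submodule.span_mono (Set.image_mono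
          fun k hk => Set.mem_Iio.2 (lt_max_of_lt_left hk.2)) (hvm i)
    intro x hx
    have hx' : x ∈ Submodule.span ℂ t := Submodule.subset_span hx
    rw [htf] at hx'
    exact hfM hx'
  · rw [htf]
    exact huf

theorem exists_orthonormal_diagonal_of_zero_diagonal (A : H →ₗ[ℂ] H) {u : ℕ → H}
    (hu : Orthonormal ℂ u) (h0 : ∀ j, inner ℂ (u j) (A (u j)) = 0)
    (h1 : ∀ N, (1 : ℂ) ∈ closure (numericalRangeOn A (Submodule.span ℂ (u '' Set.Ici N))))
    {c : ℝ} (hc0 : 0 ≤ c) (hc1 : c < 1) :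
    ∃ s : Set H, Orthonormal ℂ (Subtype.val : s → H) ∧ (∀ x ∈ s, inner ℂ x (A x) = c) ∧
      Submodule.span ℂ s = Submodule.span ℂ (Set.range u) := by
  let State := {p : ℕ × Set H // Orthonormal ℂ (Subtype.val : p.2 → H) ∧
    p.2 ⊆ Submodule.span ℂ (u '' Set.Iio p.1) ∧ ∀ x ∈ p.2, inner ℂ x (A x) = c}
  have hstep : ∀ p : State, ∃ p' : State, p.1.1 < p'.1.1 ∧ p.1.2 ⊆ p'.1.2 ∧
      u '' Set.Iio p.1.1 ⊆ Submodule.span ℂ p'.1.2 := by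
    rintro ⟨⟨N, s⟩, hs, hsN, hsc⟩
    obtain ⟨M, t, hM, hst, ht, htM, htc, hut⟩ :=
      exists_orthonormal_diagonal_step A hu h0 h1 hc0 hc1 hs hsN hsc
    exact ⟨⟨(M, t), ht, htM, htc⟩, hM, hst, hut⟩
  choose next hlt hsub hspan using hstep
  let a : ℕ → State := fun k => next^[k] ⟨(0, ∅), orthonormal_empty ℂ H, by simp, by simp⟩
  have ha : ∀ k, a (k + 1) = next (a k) := fun k => Function.iterate_succ_apply' next k _
  have hmono : Monotone fun k => (a k).1.2 := monotone_nat_of_le_succ fun k => by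
    rw [ha]; exact hsub _
  have hN : ∀ k, k ≤ (a k).1.1 := (strictMono_nat_of_lt_succ (f := fun k => (a k).1.1)
    fun k => by rw [ha]; exact hlt _).id_le
  refine ⟨⋃ k, (a k).1.2, orthonormal_iUnion_of_directed hmono.directed_le fun k => (a k).2.1,
    ?_, le_antisymm (Submodule.span_le.2 ?_) (Submodule.span_le.2 ?_)⟩
  · intro x hx
    obtain ⟨k, hk⟩ := Set.mem_iUnion.1 hx
    exact (a k).2.2.2 x hk
  · intro x hx
    obtain ⟨k, hk⟩ := Set.mem_iUnion.1 hx
    exact Submodule.span_mono (Set.image_subset_range _ _) ((a k).2.2.1 hk)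
  · rintro _ ⟨j, rfl⟩
    have h := hspan (a (j + 1)) (Set.mem_image_of_mem u (Set.mem_Iio.2 (hN (j + 1))))
    rw [← ha] at h
    exact Submodule.span_mono (Set.subset_iUnion (fun k => (a k).1.2) _) h

end ZeroDiagonal

/-! ### Essential values as limits on tails -/

section EssentialValues

variable {H : Type*} [NormedAddCommGroup H] [InnerProductSpace ℂ H]

open Filter Topology

theorem mem_closure_numericalRangeOn_of_mem_closure (T : H →L[ℂ] H) {E : Submodule ℂ H} {x : H}
    (hx : x ∈ E.topologicalClosure) (h0 : x ≠ 0) :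
    inner ℂ x (T x) / (‖x‖ : ℂ) ^ 2 ∈ closure (numericalRangeOn (T : H →ₗ[ℂ] H) E) := by
  have hx' : (‖x‖ : ℂ) ^ 2 ≠ 0 := by simpa using h0
  have hc : ContinuousAt (fun y : H => inner ℂ y (T y) / (‖y‖ : ℂ) ^ 2) x :=
    ContinuousAt.div (by fun_prop) (by fun_prop) hx'
  rw [mem_closure_iff_frequently]
  have hf : ∃ᶠ y in 𝓝 x, y ∈ (E : Set H) := mem_closure_iff_frequently.1 hx
  refine hc.tendsto.frequently ((hf.and_eventually (eventually_ne_nhds h0)).mono ?_)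
  rintro y ⟨hy, hy0⟩
  have hy' : (‖y‖ : ℂ) ^ 2 ≠ 0 := by simpa using hy0
  exact mem_numericalRangeOn_of_ne_zero hy hy0 (by
    rw [div_mul_cancel₀ _ hy']
    rfl)

theorem Orthonormal.tendsto_inner_atTop {v : ℕ → H} (hv : Orthonormal ℂ v) (x : H) :
    Tendsto (fun j => inner ℂ x (v j)) atTop (𝓝 0) := by
  have h := (hv.inner_products_summable (x := x)).tendsto_atTop_zero
  have h2 := h.sqrt
  simp only [Real.sqrt_zero, Real.sqrt_sq (norm_nonneg _)] at h2
  rw [tendsto_zero_iff_norm_tendsto_zero]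
  simpa only [norm_inner_symm] using h2

/-- Checked on the algebraic span, then extended by continuity. -/
theorem sub_sum_mem_topologicalClosure {u : ℕ → H} (hu : Orthonormal ℂ u) (N : ℕ) {x : H}
    (hx : x ∈ (Submodule.span ℂ (Set.range u)).topologicalClosure) :
    x - ∑ i ∈ Finset.range N, (inner ℂ (u i) x : ℂ) • u i ∈
      (Submodule.span ℂ (u '' Set.Ici N)).topologicalClosure := by
  refine map_mem_closure (f := fun x => x - ∑ i ∈ Finset.range N, (inner ℂ (u i) x : ℂ) • u i)
    (by fun_prop) hx ?_
  intro y hy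
  change y - ∑ i ∈ Finset.range N, (inner ℂ (u i) y : ℂ) • u i ∈ Submodule.span ℂ (u '' Set.Ici N)
  induction hy using Submodule.span_induction with
  | mem y hy =>
    obtain ⟨j, rfl⟩ := hy
    rcases lt_or_ge j N with h | h
    · rw [Finset.sum_eq_single_of_mem j (Finset.mem_range.2 h)]
      · rw [inner_self_eq_norm_sq_to_K, hu.norm_eq_one]
        simp
      · intro i _ hij
        rw [hu.inner_eq_zero hij, zero_smul]
    · rw [Finset.sum_eq_zero]
      · rw [sub_zero]
        exact Submodule.subset_span (Set.mem_image_of_mem u h)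
      · intro i hi
        rw [hu.inner_eq_zero ((Finset.mem_range.1 hi).trans_le h).ne, zero_smul]
  | zero => simp
  | add y z _ _ hy hz =>
    convert Submodule.add_mem _ hy hz using 1
    simp only [inner_add_right, add_smul, Finset.sum_add_distrib]
    abel
  | smul a y _ hy =>
    convert Submodule.smul_mem _ a hy using 1
    simp only [inner_smul_right, smul_sub, Finset.smul_sum, smul_smul]

/-- The projection `d j` of `v j` on the first `N` vectors tends to 0 in norm, since `v` tends
weakly to 0. Removing it leaves the limit unchanged and moves `v j` into the closed tail. -/
theorem mem_closure_numericalRangeOn_tail (T : H →L[ℂ] H) {u v : ℕ → H} (hu : Orthonormal ℂ u)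
    (hv : Orthonormal ℂ v)
    (hvu : ∀ j, v j ∈ (Submodule.span ℂ (Set.range u)).topologicalClosure) {b : ℂ}
    (hb : Tendsto (fun j => inner ℂ (v j) (T (v j))) atTop (𝓝 b)) (N : ℕ) :
    b ∈ closure (numericalRangeOn (T : H →ₗ[ℂ] H) (Submodule.span ℂ (u '' Set.Ici N))) := by
  set d : ℕ → H := fun j => ∑ i ∈ Finset.range N, (inner ℂ (u i) (v j) : ℂ) • u i with hd
  have hd0 : Tendsto d atTop (𝓝 0) := by
    have h := tendsto_finsetSum (Finset.range N) fun i _ =>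
      (hv.tendsto_inner_atTop (u i)).smul_const (u i)
    simpa using h
  have hbound : ∀ x y : ℕ → H, Tendsto (fun j => ‖x j‖ * ‖y j‖) atTop (𝓝 0) →
      Tendsto (fun j => inner ℂ (x j) (y j)) atTop (𝓝 0) := fun x y h =>
    squeeze_zero_norm (fun j => norm_inner_le_norm _ _) h
  have hdn : Tendsto (fun j => ‖d j‖) atTop (𝓝 0) := by simpa using hd0.norm
  have hTd : Tendsto (fun j => ‖T (d j)‖) atTop (𝓝 0) := by
    simpa using ((T.continuous.tendsto 0).comp hd0).norm
  have e1 : Tendsto (fun j => inner ℂ (v j) (T (d j))) atTop (𝓝 0) :=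
    hbound _ _ (by simpa [hv.norm_eq_one] using hTd)
  have e2 : Tendsto (fun j => inner ℂ (d j) (T (v j))) atTop (𝓝 0) := by
    refine hbound _ _ (squeeze_zero (fun j => by positivity) (fun j => ?_)
      (by simpa using hdn.mul_const ‖T‖))
    gcongr
    simpa [hv.norm_eq_one] using T.le_opNorm (v j)
  have e3 : Tendsto (fun j => inner ℂ (d j) (T (d j))) atTop (𝓝 0) :=
    hbound _ _ (by simpa using hdn.mul hTd)
  have hq : Tendsto (fun j => inner ℂ (v j - d j) (T (v j - d j))) atTop (𝓝 b) := by
    have h := ((hb.sub e1).sub e2).add e3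
    simp only [sub_zero, add_zero] at h
    refine h.congr fun j => ?_
    simp only [map_sub, inner_sub_left, inner_sub_right]
    ring
  have hn : Tendsto (fun j => ‖v j - d j‖) atTop (𝓝 1) := by
    rw [← tendsto_sub_nhds_zero_iff]
    refine squeeze_zero_norm (fun j => ?_) hdn
    have h := abs_norm_sub_norm_le (v j - d j) (v j)
    rw [hv.norm_eq_one, sub_sub_cancel_left, norm_neg] at h
    exact h
  have hquot : Tendsto (fun j => inner ℂ (v j - d j) (T (v j - d j)) / (‖v j - d j‖ : ℂ) ^ 2)
      atTop (𝓝 b) := by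
    have h := hq.div (((Complex.continuous_ofReal.tendsto 1).comp hn).pow 2) (by simp)
    simp only [Complex.ofReal_one, one_pow, div_one] at h
    exact h
  refine isClosed_closure.mem_of_tendsto hquot ?_
  filter_upwards [hn.eventually_ne one_ne_zero] with j hj
  exact mem_closure_numericalRangeOn_of_mem_closure T
    (sub_sum_mem_topologicalClosure hu N (hvu j)) (norm_ne_zero_iff.1 hj)

theorem exists_orthonormal_diagonal (T : H →L[ℂ] H) {u v : ℕ → H} (hu : Orthonormal ℂ u)
    (hv : Orthonormal ℂ v)
    (hvu : ∀ j, v j ∈ (Submodule.span ℂ (Set.range u)).topologicalClosure) {a b : ℂ}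
    (ha : ∀ j, inner ℂ (u j) (T (u j)) = a)
    (hb : Tendsto (fun j => inner ℂ (v j) (T (v j))) atTop (𝓝 b)) {t : ℝ} (ht0 : 0 < t)
    (ht1 : t ≤ 1) :
    ∃ s : Set H, Orthonormal ℂ (Subtype.val : s → H) ∧
      (∀ x ∈ s, inner ℂ x (T x) = (t : ℂ) * a + (1 - (t : ℂ)) * b) ∧
      Submodule.span ℂ s = Submodule.span ℂ (Set.range u) := by
  rcases eq_or_ne a b with rfl | hab
  · refine ⟨Set.range u, ?_, ?_, rfl⟩
    · exact hu.toSubtypeRange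
    · rintro _ ⟨j, rfl⟩
      rw [ha]
      ring
  have hba : b - a ≠ 0 := sub_ne_zero.2 hab.symm
  set A : H →ₗ[ℂ] H := (b - a)⁻¹ • ((T : H →ₗ[ℂ] H) - a • (1 : H →ₗ[ℂ] H)) with hA
  have hAT : ∀ x : H, ‖x‖ = 1 → inner ℂ x (A x) = (b - a)⁻¹ * (inner ℂ x (T x) - a) :=
    fun x hx => inner_smul_sub_smul_one _ _ _ hx
  obtain ⟨s, hs, hsc, hsu⟩ := exists_orthonormal_diagonal_of_zero_diagonal A hu
    (fun j => by rw [hAT _ (hu.norm_eq_one j), ha]; simp)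
    (fun N => by
      have h := map_mem_closure (f := fun z : ℂ => (b - a)⁻¹ * (z - a)) (by fun_prop)
        (mem_closure_numericalRangeOn_tail T hu hv hvu hb N)
        (t := numericalRangeOn A (Submodule.span ℂ (u '' Set.Ici N)))
        (by
          rintro _ ⟨x, hx, hxn, rfl⟩
          exact ⟨x, hx, hxn, hAT x hxn⟩)
      rwa [inv_mul_cancel₀ hba] at h)
    -- The value 1 - t of `A` corresponds to t·a + (1 - t)·b for `T`; `0 < t` keeps it below 1.
    (c := 1 - t) (by linarith) (by linarith)
  refine ⟨s, hs, fun x hx => ?_, hsu⟩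
  have h := hsc x hx
  rw [hAT x (hs.norm_eq_one ⟨x, hx⟩)] at h
  field_simp at h
  push_cast at h
  linear_combination h

end EssentialValues

/-! ### Decomposition of two bases into countable components -/

section Components

variable {H : Type*} [NormedAddCommGroup H] [InnerProductSpace ℂ H]

open Filter Topology

theorem Orthonormal.finite_of_forall_mem_topologicalClosure {κ κ' : Type*} [Finite κ] {u : κ → H}
    {v : κ' → H} (hv : Orthonormal ℂ v)
    (h : ∀ k, v k ∈ (Submodule.span ℂ (Set.range u)).topologicalClosure) : Finite κ' := by
  have hfin : FiniteDimensional ℂ (Submodule.span ℂ (Set.range u)) :=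
    FiniteDimensional.span_of_finite ℂ (Set.finite_range u)
  rw [(Submodule.closed_of_finiteDimensional _).submodule_topologicalClosure_eq] at h
  have hli : LinearIndependent ℂ fun k => (⟨v k, h k⟩ : Submodule.span ℂ (Set.range u)) :=
    LinearIndependent.of_comp (Submodule.subtype _) hv.linearIndependent
  exact hli.finite

theorem exists_orthonormal_diagonal_of_infinite (T : H →L[ℂ] H) {κ : Type*} [Countable κ]
    {u : κ → H} {v : ℕ → H} (hu : Orthonormal ℂ u) (hv : Orthonormal ℂ v)
    (hvu : ∀ j, v j ∈ (Submodule.span ℂ (Set.range u)).topologicalClosure) {a b : ℂ}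
    (ha : ∀ j, inner ℂ (u j) (T (u j)) = a)
    (hb : Tendsto (fun j => inner ℂ (v j) (T (v j))) atTop (𝓝 b)) {t : ℝ} (ht0 : 0 < t)
    (ht1 : t ≤ 1) :
    ∃ s : Set H, Orthonormal ℂ (Subtype.val : s → H) ∧
      (∀ x ∈ s, inner ℂ x (T x) = (t : ℂ) * a + (1 - (t : ℂ)) * b) ∧
      Submodule.span ℂ s = Submodule.span ℂ (Set.range u) := by
  have : Infinite κ := by
    by_contra hκ
    rw [not_infinite_iff_finite] at hκ
    have := hv.finite_of_forall_mem_topologicalClosure hvu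
    exact not_finite ℕ
  obtain ⟨e⟩ := nonempty_equiv_of_countable (α := ℕ) (β := κ)
  have hr : Set.range (u ∘ e) = Set.range u := e.surjective.range_comp u
  rw [← hr] at hvu ⊢
  exact exists_orthonormal_diagonal T (hu.comp e e.injective) hv hvu (fun j => ha _) hb ht0 ht1

/-- For finite families the two traces agree, so `a = b` unless the family is empty; for infinite
ones a sequence of vectors of `v` makes `b` an essential value. -/
theorem exists_orthonormal_diagonal_of_closure_eq (T : H →L[ℂ] H) {κ κ' : Type*} [Countable κ]
    {u : κ → H} {v : κ' → H} (hu : Orthonormal ℂ u) (hv : Orthonormal ℂ v)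
    (huv : ∀ j, u j ∈ (Submodule.span ℂ (Set.range v)).topologicalClosure)
    (hvu : ∀ j, v j ∈ (Submodule.span ℂ (Set.range u)).topologicalClosure) {a b : ℂ}
    (ha : ∀ j, inner ℂ (u j) (T (u j)) = a) (hb : ∀ j, inner ℂ (v j) (T (v j)) = b) {t : ℝ}
    (ht0 : 0 < t) (ht1 : t ≤ 1) :
    ∃ s : Set H, Orthonormal ℂ (Subtype.val : s → H) ∧
      (∀ x ∈ s, inner ℂ x (T x) = (t : ℂ) * a + (1 - (t : ℂ)) * b) ∧
      Submodule.span ℂ s = Submodule.span ℂ (Set.range u) := by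
  cases finite_or_infinite κ'
  · have hκ := hu.finite_of_forall_mem_topologicalClosure huv
    have := Fintype.ofFinite κ
    have := Fintype.ofFinite κ'
    have hfu : FiniteDimensional ℂ (Submodule.span ℂ (Set.range u)) :=
      FiniteDimensional.span_of_finite ℂ (Set.finite_range u)
    have hfv : FiniteDimensional ℂ (Submodule.span ℂ (Set.range v)) :=
      FiniteDimensional.span_of_finite ℂ (Set.finite_range v)
    rw [(Submodule.closed_of_finiteDimensional _).submodule_topologicalClosure_eq] at huv hvu
    obtain ⟨hcard, hsum⟩ := sum_inner_eq_of_span_range_eq (T : H →ₗ[ℂ] H) hu hv (le_antisymm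
      (Submodule.span_le.2 (Set.range_subset_iff.2 huv))
      (Submodule.span_le.2 (Set.range_subset_iff.2 hvu)))
    simp only [ContinuousLinearMap.coe_coe, ha, hb, Finset.sum_const, Finset.card_univ,
      nsmul_eq_mul, hcard] at hsum
    refine ⟨Set.range u, hu.toSubtypeRange, ?_, rfl⟩
    rintro _ ⟨j, rfl⟩
    have hpos : (Fintype.card κ' : ℂ) ≠ 0 := by
      rw [← hcard]
      exact Nat.cast_ne_zero.2 (Fintype.card_pos_iff.2 ⟨j⟩).ne'
    rw [ha, ← mul_left_cancel₀ hpos hsum]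
    ring
  · exact exists_orthonormal_diagonal_of_infinite T hu
      (hv.comp _ (Infinite.natEmbedding κ').injective) (fun j => hvu _) ha
      (by simp [hb]) ht0 ht1

theorem countable_setOf_reflTransGen {α : Type*} {r : α → α → Prop}
    (h : ∀ a, {b | r a b}.Countable) (a : α) : {b | Relation.ReflTransGen r a b}.Countable := by
  -- `S n` collects the points reached in exactly `n` steps.
  let S : ℕ → Set α := fun n => Nat.rec {a} (fun _ X => ⋃ x ∈ X, {b | r x b}) n
  have hS : ∀ n, (S n).Countable := by
    intro n
    induction n with
    | zero => exact Set.countable_singleton a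
    | succ n ih => exact ih.biUnion fun x _ => h x
  refine (Set.countable_iUnion hS).mono fun b hb => ?_
  rw [Set.mem_ofPred_eq] at hb
  induction hb with
  | refl => exact Set.mem_iUnion.2 ⟨0, rfl⟩
  | tail _ hbc ih =>
    obtain ⟨n, hn⟩ := Set.mem_iUnion.1 ih
    exact Set.mem_iUnion.2 ⟨n + 1, Set.mem_biUnion hn hbc⟩

theorem Orthonormal.countable_inner_ne_zero {κ : Type*} {u : κ → H} (hu : Orthonormal ℂ u)
    (x : H) : {k | inner ℂ (u k) x ≠ 0}.Countable :=
  (hu.inner_products_summable (x := x)).countable_support.mono fun k hk => by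
    simpa using hk

theorem Orthonormal.countable_of_separableSpace [TopologicalSpace.SeparableSpace H]
    {κ : Type*} {u : κ → H} (hu : Orthonormal ℂ u) : Countable κ := by
  obtain ⟨D, hD, hDd⟩ := TopologicalSpace.exists_countable_dense H
  rw [← Set.countable_univ_iff]
  refine (hD.biUnion fun x _ => hu.countable_inner_ne_zero x).mono fun k _ => ?_
  by_contra hk
  have h0 : ∀ x ∈ D, inner ℂ (u k) x = 0 := fun x hx => by
    by_contra h
    exact hk (Set.mem_biUnion hx h)
  exact hu.ne_zero k (hDd.eq_zero_of_inner_left ℂ h0)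

theorem HilbertBasis.mem_topologicalClosure_span {ι : Type*} (b : HilbertBasis ι ℂ H) {x : H}
    {s : Set ι} (h : ∀ k, inner ℂ (b k) x ≠ 0 → k ∈ s) :
    x ∈ (Submodule.span ℂ (Set.range fun k : s => b k)).topologicalClosure := by
  refine (Submodule.isClosed_topologicalClosure _).mem_of_tendsto (b.hasSum_repr x)
    (Eventually.of_forall fun F => Submodule.sum_mem _ fun k _ => ?_)
  rw [b.repr_apply_apply]
  by_cases hk : inner ℂ (b k) x = 0
  · rw [hk, zero_smul]
    exact Submodule.zero_mem _
  · exact Submodule.smul_mem _ _ (Submodule.le_topologicalClosure _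
      (Submodule.subset_span ⟨⟨k, h k hk⟩, rfl⟩))

/-- Two indices of the basis `b` are linked if some vector of the basis `d` is orthogonal to
neither of the two basis vectors. -/
def basisLink {ι ι' : Type*} (b : HilbertBasis ι ℂ H) (d : HilbertBasis ι' ℂ H) (i j : ι) : Prop :=
  ∃ k, inner ℂ (d k) (b i) ≠ 0 ∧ inner ℂ (d k) (b j) ≠ 0

instance {ι ι' : Type*} (b : HilbertBasis ι ℂ H) (d : HilbertBasis ι' ℂ H) :
    Std.Symm (basisLink b d) :=
  ⟨fun _ _ ⟨k, h⟩ => ⟨k, h.symm⟩⟩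

theorem countable_basisLink {ι ι' : Type*} (b : HilbertBasis ι ℂ H) (d : HilbertBasis ι' ℂ H)
    (i : ι) : {j | basisLink b d i j}.Countable := by
  refine ((d.orthonormal.countable_inner_ne_zero (b i)).biUnion
    fun k _ => b.orthonormal.countable_inner_ne_zero (d k)).mono ?_
  rintro j ⟨k, hi, hj⟩
  exact Set.mem_biUnion hi fun h => hj (inner_eq_zero_symm.1 h)

/-- The equivalence relation generated by `basisLink`. -/
def basisLinkSetoid {ι ι' : Type*} (b : HilbertBasis ι ℂ H) (d : HilbertBasis ι' ℂ H) :
    Setoid ι where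
  r := Relation.ReflTransGen (basisLink b d)
  iseqv := ⟨fun _ => .refl, fun h => Relation.ReflTransGen.stdSymm.symm _ _ h,
    fun h h' => h.trans h'⟩

theorem exists_orthonormal_diagonal_of_hilbertBases (T : H →L[ℂ] H) {ι ι' : Type*}
    (b : HilbertBasis ι ℂ H) (d : HilbertBasis ι' ℂ H) {α β : ℂ}
    (hb : ∀ j, inner ℂ (b j) (T (b j)) = α) (hd : ∀ j, inner ℂ (d j) (T (d j)) = β) {t : ℝ}
    (ht0 : 0 < t) (ht1 : t ≤ 1) :
    ∃ s : Set H, Orthonormal ℂ (Subtype.val : s → H) ∧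
      (∀ x ∈ s, inner ℂ x (T x) = (t : ℂ) * α + (1 - (t : ℂ)) * β) ∧
      Submodule.span ℂ s = Submodule.span ℂ (Set.range b) := by
  classical
  let J : Quotient (basisLinkSetoid b d) → Set ι := fun q => {j | Quotient.mk _ j = q}
  let K : Quotient (basisLinkSetoid b d) → Set ι' :=
    fun q => {k | ∃ j ∈ J q, inner ℂ (d k) (b j) ≠ 0}
  have hJ : ∀ q, Countable (J q) := by
    intro q
    obtain ⟨i, rfl⟩ := Quotient.exists_rep q
    refine ((countable_setOf_reflTransGen (countable_basisLink b d) i).mono ?_).to_subtype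
    intro j hj
    exact (basisLinkSetoid b d).symm (Quotient.exact hj)
  have key : ∀ q, ∃ s : Set H, Orthonormal ℂ (Subtype.val : s → H) ∧
      (∀ x ∈ s, inner ℂ x (T x) = (t : ℂ) * α + (1 - (t : ℂ)) * β) ∧
      Submodule.span ℂ s = Submodule.span ℂ (Set.range fun j : J q => b j) := by
    intro q
    refine exists_orthonormal_diagonal_of_closure_eq T
      (b.orthonormal.comp _ Subtype.val_injective)
      (d.orthonormal.comp (Subtype.val : K q → ι') Subtype.val_injective)
      (fun j => d.mem_topologicalClosure_span fun k hk => ⟨j, j.2, hk⟩)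
      (fun k => b.mem_topologicalClosure_span fun j hj => ?_) (fun _ => hb _) (fun _ => hd _)
      ht0 ht1
    -- A vector `d k` meeting one `b i` of the class links it to every `b j` it meets, so all of
    -- these lie in the class.
    obtain ⟨i, hi, hki⟩ := k.2
    have hij : basisLink b d j i := ⟨k, fun h => hj (inner_eq_zero_symm.1 h), hki⟩
    exact (Quotient.sound (s := basisLinkSetoid b d) (.single hij)).trans hi
  choose s hs hsc hsu using key
  have hrange : ∀ q, (Set.range fun j : J q => b j) = b '' J q := fun q => by
    ext y; simp
  refine ⟨⋃ q, s q, ?_, ?_, le_antisymm (Submodule.span_le.2 ?_) (Submodule.span_le.2 ?_)⟩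
  · rw [orthonormal_subtype_iff_ite]
    intro x hx y hy
    obtain ⟨p, hp⟩ := Set.mem_iUnion.1 hx
    obtain ⟨q, hq⟩ := Set.mem_iUnion.1 hy
    rcases eq_or_ne p q with rfl | hpq
    · exact orthonormal_subtype_iff_ite.1 (hs p) x hp y hq
    · have hxy : inner ℂ x y = 0 :=
        b.orthonormal.inner_eq_zero_of_mem_span_image (s := J p) (t := J q)
          (Set.disjoint_left.2 fun j hj hj' => hpq (hj.symm.trans hj'))
          (by rw [← hrange, ← hsu]; exact Submodule.subset_span hp)
          (by rw [← hrange, ← hsu]; exact Submodule.subset_span hq)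
      rw [hxy, if_neg]
      rintro rfl
      have hn := (hs p).norm_eq_one ⟨x, hp⟩
      rw [inner_self_eq_zero] at hxy
      simp [hxy] at hn
  · intro x hx
    obtain ⟨q, hq⟩ := Set.mem_iUnion.1 hx
    exact hsc q x hq
  · intro x hx
    obtain ⟨q, hq⟩ := Set.mem_iUnion.1 hx
    have h : x ∈ Submodule.span ℂ (s q) := Submodule.subset_span hq
    rw [hsu, hrange] at h
    exact Submodule.span_mono (Set.image_subset_range _ _) h
  · rintro _ ⟨j, rfl⟩
    have h : b j ∈ Submodule.span ℂ (s (Quotient.mk _ j)) := by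
      rw [hsu]
      exact Submodule.subset_span ⟨⟨j, rfl⟩, rfl⟩
    exact Submodule.span_mono (Set.subset_iUnion s _) h

end Components

/-! ### Assembly of the theorem -/

theorem mem_constantDiagonals_of_span_eq {H : Type u} [NormedAddCommGroup H]
    [InnerProductSpace ℂ H] [CompleteSpace H] {T : H →L[ℂ] H} {c : ℂ} {ι : Type*}
    (b : HilbertBasis ι ℂ H) {s : Set H} (hs : Orthonormal ℂ (Subtype.val : s → H))
    (hsc : ∀ x ∈ s, inner ℂ x (T x) = c)
    (hsb : Submodule.span ℂ s = Submodule.span ℂ (Set.range b)) : c ∈ constantDiagonals T := by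
  refine ⟨s, HilbertBasis.mk hs ?_, fun j => ?_⟩
  · rw [Subtype.range_coe, hsb, b.dense_span]
  · rw [HilbertBasis.coe_mk]
    exact hsc j j.2

theorem mainTheorem1 {H : Type u} [NormedAddCommGroup H] [InnerProductSpace ℂ H] [CompleteSpace H]
    (T : H →L[ℂ] H) :
    (TopologicalSpace.SeparableSpace H →
      ∀ α ∈ constantDiagonals T, ∀ β ∈ essentialNumericalRange T, ∀ t : ℝ, 0 < t → t < 1 →
        (t : ℂ) * α + (1 - (t : ℂ)) * β ∈ constantDiagonals T) ∧
    Convex ℝ (constantDiagonals T) := by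
  constructor
  · rintro hsep α ⟨ι, b, hb⟩ β ⟨v, hv, hvβ⟩ t ht0 ht1
    have hι : Countable ι := b.orthonormal.countable_of_separableSpace
    obtain ⟨s, hs, hsc, hsb⟩ := exists_orthonormal_diagonal_of_infinite T b.orthonormal hv
      (fun j => by rw [b.dense_span]; trivial) hb hvβ ht0 ht1.le
    exact mem_constantDiagonals_of_span_eq b hs hsc hsb
  · rintro α ⟨ι, b, hb⟩ β ⟨ι', d, hd⟩ p q hp hq hpq
    -- The construction starts from `b` and needs positive weight on α; at weight 0 the basis `d`
    -- serves.
    rcases hp.eq_or_lt with rfl | hp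
    · rw [zero_add] at hpq
      rw [hpq, zero_smul, one_smul, zero_add]
      exact ⟨ι', d, hd⟩
    · obtain ⟨s, hs, hsc, hsb⟩ :=
        exists_orthonormal_diagonal_of_hilbertBases T b d hb hd hp (by linarith)
      have hq' : q = 1 - p := by linarith
      rw [hq', Complex.real_smul, Complex.real_smul]
      push_cast
      exact mem_constantDiagonals_of_span_eq b hs hsc hsb
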